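/- A mixed graph $G=(V,\mathcal A)$ is a finite set $V$ with a set $\mathcal A$ of ordered pairs of distinct vertices (arcs); it is oriented if $(u,v)$ and $(v,u)$ are never both arcs. Its underlying graph $\Gamma(G)$ joins $u$ and $v$ when $(u,v)\in\mathcal A$ or $(v,u)\in\mathcal A$; $G$ is bipartite if $\Gamma(G)$ is, and the odd circumference of $G$ is the length of a longest odd cycle of $\Gamma(G)$. For $\theta\in\mathbb R$, $H_\theta(G)\in\mathbb C^{V\times V}$ is the Hermitian matrix whose $(u,v)$ entry is $1$ if both $(u,v)$ and $(v,u)$ are arcs, $e^{i\theta}$ if only $(u,v)$ is an arc, $e^{-i\theta}$ if only $(v,u)$ is an arc, and $0$ otherwise. $G$ has the $\theta$-symmetric spectrum if the multiset of eigenvalues of $H_\theta(G)$ (with multiplicities) is symmetric with respect to $0$. For $0\le a\le t-1$ let $P_t^{(a,t-1-a)}$ be the oriented path on $p_1,\dots,p_t$ with arcs $(p_i,p_{i+1})$ for $1\le i\le a$ and $(p_{i+1},p_i)$ for $a<i\le t-1$. For $t\ge 2$ and integers $s_1,\dots,s_t\ge 0$ with $s_1+\dots+s_t\ge 1$, the oriented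 book graph $G(s_1,\dots,s_t)$ is obtained as follows: take vertices $x,y$ with the arc $(x,y)$ and, for $1\le j\le t$ and $1\le k\le s_j$, a vertex $z_j^{(k)}$; join $x$ to $z_j^{(k)}$ by a copy of $P_t^{(0,t-1)}$ with $p_1=x$, $p_t=z_j^{(k)}$, and join $y$ to $z_j^{(k)}$ by a copy of $P_t^{(j-1,t-j)}$ with $p_1=y$, $p_t=z_j^{(k)}$, all these paths having pairwise disjoint sets of inner vertices, which are new vertices. Write $G(2^{(n)},1)$ for $G(2,\dots,2,1)$ with $n$ twos. **Proposition.** Let $m\ge 3$ be an odd integer, let $l$ be an integer with $\gcd(l,m)=1$, and let $\theta=\frac lm\pi$. Then $G(2^{(\frac{m-1}{2})},1)$ is a non-bipartite oriented graph, its odd circumference is $m$, and it has the $\theta$-symmetric spectrum. -/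

import Mathlib

/-- A mixed graph on the vertex set `V`: a set of arcs, that is, of ordered pairs of distinct
vertices. -/
structure MixedGraph (V : Type*) where
  /-- `Arc u v` says that the ordered pair `(u, v)` is an arc. -/
  Arc : V → V → Prop
  /-- There are no loops. -/
  loopless : ∀ v, ¬ Arc v v

namespace MixedGraph

/-- The underlying graph: `u` and `v` are joined by an edge when `(u, v)` or `(v, u)` is an arc. -/
def underlying {V : Type*} (G : MixedGraph V) : SimpleGraph V where
  Adj u v := G.Arc u v ∨ G.Arc v u
  symm := ⟨fun _ _ h => h.symm⟩
  loopless := ⟨fun v h => h.elim (G.loopless v) (G.loopless v)⟩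

/-- An oriented graph is a mixed graph without digons. -/
def IsOriented {V : Type*} (G : MixedGraph V) : Prop :=
  ∀ u v, ¬ (G.Arc u v ∧ G.Arc v u)

/-- A mixed graph is bipartite when its underlying graph is. -/
def IsBipartite {V : Type*} (G : MixedGraph V) : Prop :=
  G.underlying.IsBipartite

/-- The lengths of the odd cycles of the underlying graph. -/
def oddCycleLengths {V : Type*} (G : MixedGraph V) : Set ℕ :=
  {k | Odd k ∧ ∃ (v : V) (p : G.underlying.Walk v v), p.IsCycle ∧ p.length = k}

/-- `G` has odd circumference `k`: there are odd cycles, and the longest have length `k`. -/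
def HasOddCircumference {V : Type*} (G : MixedGraph V) (k : ℕ) : Prop :=
  IsGreatest G.oddCycleLengths k

open Classical in
/-- The `θ`-Hermitian adjacency matrix `H_θ(G)`. -/
noncomputable def hermitianAdjMatrix {V : Type*} (G : MixedGraph V) (θ : ℝ) : Matrix V V ℂ :=
  Matrix.of fun u v =>
    if G.Arc u v ∧ G.Arc v u then 1
    else if G.Arc u v then Complex.exp (Complex.I * (θ : ℂ))
    else if G.Arc v u then Complex.exp (-(Complex.I * (θ : ℂ)))
    else 0

/-- The multiset of eigenvalues (with multiplicities) of `H_θ(G)`. -/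
noncomputable def spec {V : Type*} [Fintype V] [DecidableEq V] (G : MixedGraph V) (θ : ℝ) :
    Multiset ℂ :=
  (G.hermitianAdjMatrix θ).charpoly.roots

/-- `G` has the `θ`-symmetric spectrum: the multiset of eigenvalues of `H_θ(G)` is invariant
under `μ ↦ -μ`. -/
def HasSymmetricSpectrum {V : Type*} [Fintype V] [DecidableEq V] (G : MixedGraph V) (θ : ℝ) :
    Prop :=
  (G.spec θ).map (fun μ => -μ) = G.spec θ

/-- The oriented path `P_t^{(a, t-1-a)}` with `t` vertices `0, 1, …, t-1`: the first `a` edges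
`{i, i+1}` are oriented forwards, `i → i+1`, the other `t-1-a` edges backwards, `i+1 → i`. -/
def orientedPath (t a : ℕ) : MixedGraph (Fin t) where
  Arc p q := ((q : ℕ) = p + 1 ∧ (p : ℕ) < a) ∨ ((p : ℕ) = q + 1 ∧ a ≤ (q : ℕ))
  loopless v h := by omega

/-- The sheets of `G(s_1, …, s_t)`: pairs `(j, k)` with `k` among `s_j` elements. The index
`j : Fin t` runs through `0, …, t-1`, so it stands for the argument number `j + 1`. -/
abbrev BookSheet {t : ℕ} (s : Fin t → ℕ) : Type := Σ j : Fin t, Fin (s j)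

/-- The vertices of `G(s_1, …, s_t)`: the two end vertices `x`, `y` of the common edge (the summand
`Fin 2`) and, for every sheet, the `2t-3` further vertices of a cycle of length `2t-1` through
the common edge, numbered along this cycle from `x` to `y`. -/
abbrev BookVertex {t : ℕ} (s : Fin t → ℕ) : Type := Fin 2 ⊕ (BookSheet s × Fin (2 * t - 3))

/-- The vertex `x`. -/
def bookX {t : ℕ} (s : Fin t → ℕ) : BookVertex s := Sum.inl 0

/-- The vertex `y`. -/
def bookY {t : ℕ} (s : Fin t → ℕ) : BookVertex s := Sum.inl 1

/-- The vertex at distance `i` from `x` on the path of length `2t-2` that leads from `x` to `y`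
through the sheet `σ`. For `i = 0` this is `x`, for `i = t - 1` it is the middle vertex `z` of
the sheet, and for `i ≥ 2t-2` it is `y`. -/
def sheetVertex {t : ℕ} (s : Fin t → ℕ) (σ : BookSheet s) (i : ℕ) : BookVertex s :=
  if i = 0 then bookX s
  else if h : i - 1 < 2 * t - 3 then Sum.inr (σ, ⟨i - 1, h⟩)
  else bookY s

/-- The `i`-th vertex (`0 ≤ i ≤ t-1`) of the path with `t` vertices from `x` to the vertex `z` of
the sheet `σ`. -/
def xPathVertex {t : ℕ} (s : Fin t → ℕ) (σ : BookSheet s) (i : Fin t) : BookVertex s :=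
  sheetVertex s σ i

/-- The `i`-th vertex (`0 ≤ i ≤ t-1`) of the path with `t` vertices from `y` to the vertex `z` of
the sheet `σ`. -/
def yPathVertex {t : ℕ} (s : Fin t → ℕ) (σ : BookSheet s) (i : Fin t) : BookVertex s :=
  sheetVertex s σ (2 * t - 2 - i)

/-- The vertices `xPathVertex` of one sheet are pairwise distinct. -/
theorem xPathVertex_injective {t : ℕ} (s : Fin t → ℕ) (σ : BookSheet s) :
    Function.Injective (xPathVertex s σ) := by
  intro i j h
  have hi := i.isLt
  have hj := j.isLt
  unfold xPathVertex sheetVertex bookX bookY at h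
  ext
  split_ifs at h <;> simp at h <;> omega

/-- The vertices `yPathVertex` of one sheet are pairwise distinct. -/
theorem yPathVertex_injective {t : ℕ} (s : Fin t → ℕ) (σ : BookSheet s) :
    Function.Injective (yPathVertex s σ) := by
  intro i j h
  have hi := i.isLt
  have hj := j.isLt
  unfold yPathVertex sheetVertex bookX bookY at h
  ext
  split_ifs at h <;> simp at h <;> omega

/-- The oriented book graph `G(s_1, …, s_t)` (meaningful for `t ≥ 2`). It has the arc `x → y`, and
for every sheet `σ = (j, k)` with middle vertex `z` the edge `{x, z}` is replaced by an oriented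
path `P_t^{(0, t-1)}` from `x` to `z` and the edge `{y, z}` by an oriented path
`P_t^{(j-1, t-j)}` from `y` to `z`, where `j` is counted from `1`. -/
def bookGraph {t : ℕ} (s : Fin t → ℕ) : MixedGraph (BookVertex s) where
  Arc u v :=
    (u = bookX s ∧ v = bookY s) ∨
    ∃ (σ : BookSheet s) (p q : Fin t),
      ((orientedPath t 0).Arc p q ∧ u = xPathVertex s σ p ∧ v = xPathVertex s σ q) ∨
      ((orientedPath t σ.1).Arc p q ∧ u = yPathVertex s σ p ∧ v = yPathVertex s σ q)
  loopless := by
    rintro v (⟨h1, h2⟩ | ⟨σ, p, q, ⟨h, h1, h2⟩ | ⟨h, h1, h2⟩⟩)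
    · simp [bookX, bookY, h1] at h2
    · have := xPathVertex_injective s σ (h1.symm.trans h2)
      exact (orientedPath t 0).loopless p (this ▸ h)
    · have := yPathVertex_injective s σ (h1.symm.trans h2)
      exact (orientedPath t σ.1).loopless p (this ▸ h)

/-- The arguments `(2, …, 2, 1)` with `n` twos. -/
def twosOne (n : ℕ) : Fin (n + 1) → ℕ := Fin.snoc (α := fun _ => ℕ) (fun _ => 2) 1

end MixedGraph

/-!
Put `t = (m + 1) / 2`, so that `G = G(2, …, 2, 1)` consists of `m` paths ("sheets") of even length
`2t - 2 = m - 1` from `x` to `y`, together with the edge `{x, y}`.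

*Odd cycles.* Colouring the vertices by the parity of their position in the sheet makes `{x, y}` the
only monochromatic edge, so every odd cycle passes through it (`mem_edges_of_odd_length`). The rest
of such a cycle is a path from `y` to `x` that cannot leave its sheet, so the cycle has length at
most `2t - 1 = m` (`length_le_of_isCycle_of_odd`), and each sheet gives a cycle of this length
(`exists_isCycle_bookGraph`).

*Spectrum.* Let `H = H_θ(G)`. Conjugating `-H` by the diagonal matrix of the signs of the colouring
gives `H` with the sign of the entries at `{x, y}` changed. Conjugating further by a switching
function makes all inner gains of the sheets trivial, so that the part of the matrix outside
`{x, y}` becomes a Kronecker product `1 ⊗ P` with the adjacency matrix `P` of a path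
(`charpoly_smul_hermitianAdjMatrix`). Now take the Schur complement of `1 ⊗ (X - P)`, a `2 × 2`
matrix: its determinant depends on the sign at `{x, y}` only through a multiple of the sum over all
sheets of the two gains of the cycle through `{x, y}` and the sheet, in both directions
(`Matrix.charpoly_attach_neg`). For a sheet of class `j` counted from `1` these gains are
`exp (± i (2j - 1) θ)` (`mul_prod_range_gain`), and the sum
`2 ∑_{j < t} 2 cos ((2j - 1) θ) + 2 cos (m θ)` vanishes: multiplied by `sin θ`, which is not zero,
it telescopes to a multiple of `sin (m θ) = sin (l π) = 0` (`sum_twosOne_pow_add_pow`). So `H` and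
`-H` have the same characteristic polynomial.
-/

/-! ### Adjacency in a book graph -/

namespace MixedGraph

/-- The edge between the positions `k` and `k + 1` of a sheet of class `j` (counted from `0`) is
oriented towards `x`, that is, from position `k + 1` to position `k`. -/
def TowardsX (t j k : ℕ) : Prop := k < t - 1 ∨ 2 * t - 3 < k + j

instance (t j k : ℕ) : Decidable (TowardsX t j k) := inferInstanceAs (Decidable (_ ∨ _))

theorem bookGraph_arc_iff {t : ℕ} (ht : 2 ≤ t) (s : Fin t → ℕ) (u v : BookVertex s) :
    (bookGraph s).Arc u v ↔ (u = bookX s ∧ v = bookY s) ∨ ∃ σ : BookSheet s, ∃ k < 2 * t - 2,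
      (TowardsX t σ.1 k ∧ u = sheetVertex s σ (k + 1) ∧ v = sheetVertex s σ k) ∨
      (¬ TowardsX t σ.1 k ∧ u = sheetVertex s σ k ∧ v = sheetVertex s σ (k + 1)) := by
  change (_ ∨ _) ↔ _
  refine or_congr Iff.rfl (exists_congr fun σ => ?_)
  have hσ := σ.1.isLt
  simp only [orientedPath, xPathVertex, yPathVertex, TowardsX]
  constructor
  · rintro ⟨p, q, ⟨h, rfl, rfl⟩ | ⟨h, rfl, rfl⟩⟩
    · refine ⟨q, by omega, Or.inl ⟨Or.inl (by omega), ?_, rfl⟩⟩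
      congr 1; omega
    · rcases h with h | h
      · refine ⟨2 * t - 2 - q, by omega, Or.inl ⟨by omega, ?_, rfl⟩⟩
        congr 1; omega
      · refine ⟨2 * t - 2 - p, by omega, Or.inr ⟨by omega, rfl, ?_⟩⟩
        congr 1; omega
  · rintro ⟨k, hk, ⟨h, rfl, rfl⟩ | ⟨h, rfl, rfl⟩⟩
    · by_cases hkt : k < t - 1
      · exact ⟨⟨k + 1, by omega⟩, ⟨k, by omega⟩, Or.inl ⟨Or.inr ⟨rfl, by simp⟩, rfl, rfl⟩⟩
      · refine ⟨⟨2 * t - 3 - k, by omega⟩, ⟨2 * t - 2 - k, by omega⟩,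
          Or.inr ⟨Or.inl ⟨?_, ?_⟩, ?_, ?_⟩⟩
        · dsimp only; omega
        · dsimp only; omega
        · congr 1; dsimp only; omega
        · congr 1; dsimp only; omega
    · refine ⟨⟨2 * t - 2 - k, by omega⟩, ⟨2 * t - 3 - k, by omega⟩,
          Or.inr ⟨Or.inr ⟨?_, ?_⟩, ?_, ?_⟩⟩
      · dsimp only; omega
      · dsimp only; omega
      · congr 1; dsimp only; omega
      · congr 1; dsimp only; omega

theorem sheetVertex_eq_inr_iff {t : ℕ} (s : Fin t → ℕ) (σ τ : BookSheet s) (k : ℕ)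
    (i : Fin (2 * t - 3)) : sheetVertex s σ k = Sum.inr (τ, i) ↔ σ = τ ∧ k = i + 1 := by
  have := i.isLt
  unfold sheetVertex bookX bookY
  split_ifs with h1 h2
  · simp [h1]
  · simp only [Sum.inr.injEq, Prod.mk.injEq, Fin.ext_iff]
    exact and_congr_right fun _ => by omega
  · simp only [false_iff]
    omega

theorem sheetVertex_eq_bookX_iff {t : ℕ} (s : Fin t → ℕ) (σ : BookSheet s) (k : ℕ) :
    sheetVertex s σ k = Sum.inl 0 ↔ k = 0 := by
  unfold sheetVertex bookX bookY
  split_ifs with h1 h2 <;> simp [h1]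

theorem sheetVertex_eq_bookY_iff {t : ℕ} (ht : 2 ≤ t) (s : Fin t → ℕ) (σ : BookSheet s) (k : ℕ) :
    sheetVertex s σ k = Sum.inl 1 ↔ 2 * t - 2 ≤ k := by
  unfold sheetVertex bookX bookY
  split_ifs with h1 h2 <;> simp <;> omega

theorem inr_eq_sheetVertex_iff {t : ℕ} (s : Fin t → ℕ) (σ τ : BookSheet s) (k : ℕ)
    (i : Fin (2 * t - 3)) : Sum.inr (τ, i) = sheetVertex s σ k ↔ σ = τ ∧ k = i + 1 := by
  rw [eq_comm, sheetVertex_eq_inr_iff]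

theorem bookX_eq_sheetVertex_iff {t : ℕ} (s : Fin t → ℕ) (σ : BookSheet s) (k : ℕ) :
    Sum.inl 0 = sheetVertex s σ k ↔ k = 0 := by
  rw [eq_comm, sheetVertex_eq_bookX_iff]

theorem bookY_eq_sheetVertex_iff {t : ℕ} (ht : 2 ≤ t) (s : Fin t → ℕ) (σ : BookSheet s) (k : ℕ) :
    Sum.inl 1 = sheetVertex s σ k ↔ 2 * t - 2 ≤ k := by
  rw [eq_comm, sheetVertex_eq_bookY_iff ht]

section Arcs

variable {t : ℕ} (ht : 2 ≤ t) (s : Fin t → ℕ)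
include ht

theorem bookGraph_arc_inl_inl (a b : Fin 2) :
    (bookGraph s).Arc (Sum.inl a) (Sum.inl b) ↔ a = 0 ∧ b = 1 := by
  rw [bookGraph_arc_iff ht]
  constructor
  · rintro (h | ⟨σ, k, hk, ⟨-, h1, h2⟩ | ⟨-, h1, h2⟩⟩)
    · simpa [bookX, bookY] using h
    all_goals
      exfalso
      have := sheetVertex_eq_bookX_iff s σ
      have := sheetVertex_eq_bookY_iff ht s σ
      fin_cases a <;> fin_cases b <;> simp_all [eq_comm] <;> omega
  · rintro ⟨rfl, rfl⟩
    exact Or.inl ⟨rfl, rfl⟩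

theorem bookGraph_arc_inr_inr (σ τ : BookSheet s) (i j : Fin (2 * t - 3)) :
    (bookGraph s).Arc (Sum.inr (σ, i)) (Sum.inr (τ, j)) ↔ σ = τ ∧
      (((i : ℕ) = j + 1 ∧ TowardsX t σ.1 i) ∨ ((j : ℕ) = i + 1 ∧ ¬ TowardsX t σ.1 j)) := by
  rw [bookGraph_arc_iff ht]
  simp only [bookX, reduceCtorEq, false_and, false_or, inr_eq_sheetVertex_iff]
  constructor
  · rintro ⟨σ, k, hk, ⟨h, ⟨rfl, h1⟩, rfl, h2⟩ | ⟨h, ⟨rfl, h1⟩, rfl, h2⟩⟩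
    · have : k = i := by omega
      subst this
      exact ⟨rfl, Or.inl ⟨by omega, h⟩⟩
    · have : k = j := by omega
      subst this
      exact ⟨rfl, Or.inr ⟨by omega, h⟩⟩
  · rintro ⟨rfl, ⟨h1, h⟩ | ⟨h1, h⟩⟩
    · exact ⟨σ, i, by omega, Or.inl ⟨h, ⟨rfl, rfl⟩, rfl, h1⟩⟩
    · exact ⟨σ, j, by omega, Or.inr ⟨h, ⟨rfl, h1⟩, rfl, rfl⟩⟩

/-- No arc leads from `x` into a sheet: the edges at `x` other than `{x, y}` point to `x`. -/
theorem not_bookGraph_arc_bookX_inr (σ : BookSheet s) (i : Fin (2 * t - 3)) :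
    ¬ (bookGraph s).Arc (Sum.inl 0) (Sum.inr (σ, i)) := by
  rw [bookGraph_arc_iff ht]
  simp only [bookY, reduceCtorEq, and_false, false_or, inr_eq_sheetVertex_iff,
    bookX_eq_sheetVertex_iff, TowardsX]
  rintro ⟨σ, k, hk, ⟨h, h1, rfl, h2⟩ | ⟨h, h1, rfl, h2⟩⟩ <;> omega

theorem bookGraph_arc_inr_bookX (σ : BookSheet s) (i : Fin (2 * t - 3)) :
    (bookGraph s).Arc (Sum.inr (σ, i)) (Sum.inl 0) ↔ (i : ℕ) = 0 := by
  rw [bookGraph_arc_iff ht]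
  simp only [bookX, reduceCtorEq, false_and, false_or, inr_eq_sheetVertex_iff,
    bookX_eq_sheetVertex_iff]
  constructor
  · rintro ⟨σ, k, hk, ⟨h, ⟨rfl, h1⟩, h2⟩ | ⟨h, ⟨rfl, h1⟩, h2⟩⟩
    · omega
    · exact h2.elim
  · intro h
    exact ⟨σ, 0, by omega, Or.inl ⟨Or.inl (by omega), ⟨rfl, by omega⟩, rfl⟩⟩

theorem bookGraph_arc_bookY_inr (σ : BookSheet s) (i : Fin (2 * t - 3)) :
    (bookGraph s).Arc (Sum.inl 1) (Sum.inr (σ, i)) ↔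
      (i : ℕ) = 2 * t - 4 ∧ TowardsX t σ.1 (2 * t - 3) := by
  rw [bookGraph_arc_iff ht]
  simp only [bookX, Sum.inl.injEq, false_and, false_or, inr_eq_sheetVertex_iff,
    bookY_eq_sheetVertex_iff ht, one_ne_zero]
  constructor
  · rintro ⟨σ, k, hk, ⟨h, h1, rfl, h2⟩ | ⟨h, h1, rfl, h2⟩⟩
    · obtain rfl : k = 2 * t - 3 := by omega
      exact ⟨by omega, h⟩
    · omega
  · rintro ⟨hi, h⟩
    exact ⟨σ, 2 * t - 3, by omega, Or.inl ⟨h, by omega, rfl, by omega⟩⟩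

theorem bookGraph_arc_inr_bookY (σ : BookSheet s) (i : Fin (2 * t - 3)) :
    (bookGraph s).Arc (Sum.inr (σ, i)) (Sum.inl 1) ↔
      (i : ℕ) = 2 * t - 4 ∧ ¬ TowardsX t σ.1 (2 * t - 3) := by
  rw [bookGraph_arc_iff ht]
  simp only [bookX, reduceCtorEq, false_and, false_or, inr_eq_sheetVertex_iff,
    bookY_eq_sheetVertex_iff ht]
  constructor
  · rintro ⟨σ, k, hk, ⟨h, ⟨rfl, h1⟩, h2⟩ | ⟨h, ⟨rfl, h1⟩, h2⟩⟩
    · omega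
    · obtain rfl : k = 2 * t - 3 := by omega
      exact ⟨by omega, h⟩
  · rintro ⟨hi, h⟩
    exact ⟨σ, 2 * t - 3, by omega, Or.inr ⟨h, ⟨rfl, by omega⟩, by omega⟩⟩

theorem bookGraph_isOriented : (bookGraph s).IsOriented := by
  rintro (a | ⟨σ, i⟩) (b | ⟨τ, j⟩) ⟨h1, h2⟩
  · rw [bookGraph_arc_inl_inl ht] at h1 h2
    omega
  · obtain rfl | rfl : a = 0 ∨ a = 1 := by omega
    · exact not_bookGraph_arc_bookX_inr ht s τ j h1
    · rw [bookGraph_arc_bookY_inr ht] at h1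
      rw [bookGraph_arc_inr_bookY ht] at h2
      exact h2.2 h1.2
  · obtain rfl | rfl : b = 0 ∨ b = 1 := by omega
    · exact not_bookGraph_arc_bookX_inr ht s σ i h2
    · rw [bookGraph_arc_bookY_inr ht] at h2
      rw [bookGraph_arc_inr_bookY ht] at h1
      exact h1.2 h2.2
  · rw [bookGraph_arc_inr_inr ht] at h1 h2
    obtain ⟨rfl, h1⟩ := h1
    obtain ⟨-, h2⟩ := h2
    rcases h1 with h1 | h1 <;> rcases h2 with h2 | h2
    · omega
    · exact h2.2 h1.2
    · exact h1.2 h2.2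
    · omega

end Arcs

/-! ### Odd cycles of a book graph -/

section Cycles

variable {t : ℕ} (ht : 2 ≤ t) (s : Fin t → ℕ)
include ht

theorem bookGraph_adj_sheetVertex (σ : BookSheet s) {k : ℕ} (hk : k < 2 * t - 2) :
    (bookGraph s).underlying.Adj (sheetVertex s σ k) (sheetVertex s σ (k + 1)) := by
  change _ ∨ _
  rw [bookGraph_arc_iff ht, bookGraph_arc_iff ht]
  by_cases h : TowardsX t σ.1 k
  · exact Or.inr (Or.inr ⟨σ, k, hk, Or.inl ⟨h, rfl, rfl⟩⟩)
  · exact Or.inl (Or.inr ⟨σ, k, hk, Or.inr ⟨h, rfl, rfl⟩⟩)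

/-- Every sheet closes up with the edge `{x, y}` to a cycle of length `2t - 1`. -/
theorem exists_isCycle_bookGraph (σ : BookSheet s) :
    ∃ (v : BookVertex s) (p : (bookGraph s).underlying.Walk v v),
      p.IsCycle ∧ p.length = 2 * t - 1 := by
  obtain ⟨n, hn⟩ : ∃ n, 2 * t - 1 = n + 3 := ⟨2 * t - 4, by omega⟩
  have hY : sheetVertex s σ (2 * t - 2) = bookY s :=
    (sheetVertex_eq_bookY_iff ht s σ _).2 le_rfl
  have hX : sheetVertex s σ 0 = bookX s := (sheetVertex_eq_bookX_iff s σ _).2 rfl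
  have key : ∀ a b : Fin (n + 3), ((b - a : Fin (n + 3)) : ℕ) = 1 →
      (bookGraph s).underlying.Adj (sheetVertex s σ a) (sheetVertex s σ b) := by
    intro a b h
    have ha := a.isLt
    rw [Fin.val_sub] at h
    by_cases hab : (b : ℕ) = a + 1
    · rw [hab]
      exact bookGraph_adj_sheetVertex ht s σ (by omega)
    · -- the difference is `1` modulo `n + 3`, so this is the wrap-around edge
      have hmod := Nat.mod_add_div (n + 3 - (a : ℕ) + b) (n + 3)
      rw [h] at hmod
      have hq : (n + 3 - (a : ℕ) + b) / (n + 3) < 2 := by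
        rw [Nat.div_lt_iff_lt_mul (by omega)]
        omega
      have h0 : (b : ℕ) = 0 ∧ (a : ℕ) = 2 * t - 2 := by
        generalize (n + 3 - (a : ℕ) + b) / (n + 3) = c at hmod hq
        interval_cases c <;> omega
      rw [h0.1, h0.2, hX, hY]
      exact Or.inr (Or.inl ⟨rfl, rfl⟩)
  let f : SimpleGraph.cycleGraph (n + 3) →g (bookGraph s).underlying :=
    { toFun := fun i => sheetVertex s σ i
      map_rel' := fun {a b} h => by
        rw [SimpleGraph.cycleGraph_adj'] at h
        exact h.elim (fun h => (key b a h).symm) (key a b) }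
  have hf : Function.Injective f := by
    intro a b h
    change sheetVertex s σ a = sheetVertex s σ b at h
    have ha := a.isLt
    have hb := b.isLt
    unfold sheetVertex bookX bookY at h
    ext
    split_ifs at h <;> simp at h <;> omega
  exact ⟨_, _, (SimpleGraph.cycleGraph.isCycle_cycle (n := n)).map hf, by simp [hn]⟩

/-- A walk that leaves a sheet only at `x`, where it stops, stays in this sheet. -/
theorem mem_support_of_isPath_to_bookX {u : BookVertex s}
    (p : (bookGraph s).underlying.Walk u (bookX s)) (hp : p.IsPath) (hy : bookY s ∉ p.support)
    (σ : BookSheet s) (hu : u = bookX s ∨ ∃ i, u = Sum.inr (σ, i)) (v : BookVertex s)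
    (hv : v ∈ p.support) : v = bookX s ∨ ∃ i, v = Sum.inr (σ, i) := by
  generalize hw : bookX s = w at p
  induction p with
  | nil => simp_all
  | @cons a b c h q ih =>
    subst hw
    rw [SimpleGraph.Walk.cons_isPath_iff] at hp
    rw [SimpleGraph.Walk.support_cons, List.mem_cons] at hv hy
    push Not at hy
    rcases hv with rfl | hv
    · exact hu
    refine ih ?_ rfl hp.1 hy.2 hv
    rcases hu with rfl | ⟨i, rfl⟩
    · exact absurd q.end_mem_support hp.2
    rcases b with b | ⟨τ, j⟩
    · obtain rfl | rfl : b = 0 ∨ b = 1 := by omega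
      · exact Or.inl rfl
      · exact absurd q.start_mem_support hy.2
    · change _ ∨ _ at h
      rw [bookGraph_arc_inr_inr ht, bookGraph_arc_inr_inr ht] at h
      have : τ = σ := by tauto
      exact Or.inr ⟨j, by rw [this]⟩

/-- A cycle whose first step is the edge from `x` to `y` runs through one sheet only. -/
theorem length_le_of_isCycle_cons (h : (bookGraph s).underlying.Adj (bookX s) (bookY s))
    (q : (bookGraph s).underlying.Walk (bookY s) (bookX s))
    (hq : (SimpleGraph.Walk.cons h q).IsCycle) :
    (SimpleGraph.Walk.cons h q).length ≤ 2 * t - 1 := by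
  have hl := hq.three_le_length
  rw [SimpleGraph.Walk.cons_isCycle_iff] at hq
  obtain ⟨hq, -⟩ := hq
  rw [SimpleGraph.Walk.length_cons] at hl ⊢
  cases q with
  | @cons _ b _ h' r =>
    rw [SimpleGraph.Walk.cons_isPath_iff] at hq
    rw [SimpleGraph.Walk.length_cons] at hl ⊢
    rcases b with b | ⟨σ, i⟩
    · exfalso
      obtain rfl | rfl : b = 0 ∨ b = 1 := by omega
      · have := SimpleGraph.Walk.length_eq_zero_iff.2 (SimpleGraph.Walk.isPath_iff_nil.1 hq.1)
        change r.length = 0 at this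
        omega
      · exact h'.ne rfl
    · have hsub : r.support.toFinset ⊆ insert (bookX s)
          (Finset.univ.image fun i : Fin (2 * t - 3) => (Sum.inr (σ, i) : BookVertex s)) := by
        intro v hv
        rw [List.mem_toFinset] at hv
        have := mem_support_of_isPath_to_bookX ht s r hq.1 hq.2 σ (Or.inr ⟨i, rfl⟩) v hv
        simp only [Finset.mem_insert, Finset.mem_image, Finset.mem_univ, true_and]
        exact this.imp_right fun ⟨i, hi⟩ => ⟨i, hi.symm⟩
      have hcard := (Finset.card_le_card hsub).trans (Finset.card_insert_le _ _)
      rw [List.toFinset_card_of_nodup hq.1.support_nodup, SimpleGraph.Walk.length_support] at hcard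
      have := (Finset.card_image_le (s := Finset.univ)
        (f := fun i : Fin (2 * t - 3) => (Sum.inr (σ, i) : BookVertex s)))
      rw [Finset.card_univ, Fintype.card_fin] at this
      omega

/-- Without the edge `{x, y}` the parity of the position is a proper `2`-colouring: `x` and `y` have
the even positions `0` and `2t - 2`, and `Sum.inr (σ, i)` has the position `i + 1`. -/
def positionColoring :
    ((bookGraph s).underlying.deleteEdges {s(bookX s, bookY s)}).Coloring Bool :=
  SimpleGraph.Coloring.mk (fun v => v.elim (fun _ => false) fun w => decide (Even (w.2 : ℕ))) (by
    have key : ∀ u v, (bookGraph s).Arc u v → ¬ s(u, v) = s(bookX s, bookY s) →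
        (Sum.elim (fun _ => false) (fun w => decide (Even (w.2 : ℕ))) u : Bool) ≠
          Sum.elim (fun _ => false) (fun w => decide (Even (w.2 : ℕ))) v := by
      rintro (a | ⟨σ, i⟩) (b | ⟨τ, j⟩) h hne
      · rw [bookGraph_arc_inl_inl ht] at h
        exact absurd (by rw [h.1, h.2]; rfl) hne
      · obtain rfl | rfl : a = 0 ∨ a = 1 := by omega
        · exact absurd h (not_bookGraph_arc_bookX_inr ht s τ j)
        · rw [bookGraph_arc_bookY_inr ht] at h
          have : Even (j : ℕ) := by rw [h.1]; exact ⟨t - 2, by omega⟩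
          simp [this]
      · obtain rfl | rfl : b = 0 ∨ b = 1 := by omega
        · rw [bookGraph_arc_inr_bookX ht] at h
          simp [h]
        · rw [bookGraph_arc_inr_bookY ht] at h
          have : Even (i : ℕ) := by rw [h.1]; exact ⟨t - 2, by omega⟩
          simp [this]
      · rw [bookGraph_arc_inr_inr ht] at h
        rcases h.2 with h | h <;>
          simp only [Sum.elim_inr, h.1, Nat.even_add_one, ne_eq, decide_eq_decide] <;> tauto
    intro u v h
    rw [SimpleGraph.deleteEdges_adj] at h
    rcases h.1 with h1 | h1
    · exact key u v h1 h.2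
    · exact (key v u h1 (by rw [Sym2.eq_swap]; exact h.2)).symm)

/-- An odd cycle uses the edge `{x, y}`, since the graph without it is `2`-colourable. -/
theorem mem_edges_of_odd_length {v : BookVertex s} (p : (bookGraph s).underlying.Walk v v)
    (hodd : Odd p.length) : s(bookX s, bookY s) ∈ p.edges := by
  by_contra h
  have h' : ∀ e ∈ p.edges, e ∉ ({s(bookX s, bookY s)} : Set (Sym2 (BookVertex s))) := by
    rintro e he rfl
    exact h he
  have := (positionColoring ht s).odd_length_iff_not_congr (p.toDeleteEdges _ h')
  rw [SimpleGraph.Walk.toDeleteEdges, SimpleGraph.Walk.length_transfer] at this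
  have := this.1 hodd
  tauto

theorem length_le_of_isCycle_of_odd {v : BookVertex s} (p : (bookGraph s).underlying.Walk v v)
    (hp : p.IsCycle) (hodd : Odd p.length) : p.length ≤ 2 * t - 1 := by
  have he := mem_edges_of_odd_length ht s p hodd
  have hx := p.fst_mem_support_of_mem_edges he
  have hc := hp.rotate hx
  rw [← SimpleGraph.Walk.length_rotate p _ hx] at hodd ⊢
  replace he := mem_edges_of_odd_length ht s _ hodd
  generalize p.rotate _ hx = c at hc he
  -- a cycle at `x` that uses the edge `{x, y}` has it as first or as last edge
  have hfirst : ∀ c : (bookGraph s).underlying.Walk (bookX s) (bookX s), c.IsCycle →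
      c.snd = bookY s → c.length ≤ 2 * t - 1 := by
    intro c hc hsnd
    cases c with
    | nil => simp
    | cons h q =>
      rw [SimpleGraph.Walk.snd_cons] at hsnd
      subst hsnd
      exact length_le_of_isCycle_cons ht s h q hc
  by_cases hs : c.snd = bookY s
  · exact hfirst c hc hs
  · rw [← SimpleGraph.Walk.length_reverse]
    refine hfirst _ hc.reverse ?_
    rw [SimpleGraph.Walk.snd_reverse]
    cases c with
    | nil => simp at he
    | cons h q =>
      have hq := (SimpleGraph.Walk.cons_isCycle_iff _ _).1 hc
      rw [SimpleGraph.Walk.snd_cons] at hs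
      rw [SimpleGraph.Walk.edges_cons, List.mem_cons] at he
      rcases he with he | he
      · exact absurd (Sym2.congr_right.1 he).symm hs
      · rw [SimpleGraph.Walk.penultimate_cons_of_not_nil]
        · exact (hq.1.eq_penultimate_of_mem_edges he).symm
        · intro hnil
          rw [← SimpleGraph.Walk.length_eq_zero_iff] at hnil
          have := hc.three_le_length
          simp [hnil] at this

theorem bookGraph_hasOddCircumference (σ : BookSheet s) :
    (bookGraph s).HasOddCircumference (2 * t - 1) := by
  refine ⟨⟨⟨t - 1, by omega⟩, exists_isCycle_bookGraph ht s σ⟩, ?_⟩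
  rintro k ⟨hk, v, p, hp, rfl⟩
  exact length_le_of_isCycle_of_odd ht s p hp hk

end Cycles

theorem not_isBipartite_of_hasOddCircumference {V : Type*} {G : MixedGraph V} {k : ℕ}
    (h : G.HasOddCircumference k) : ¬ G.IsBipartite := by
  obtain ⟨⟨hk, v, p, -, rfl⟩, -⟩ := h
  intro hb
  exact Nat.not_even_iff_odd.2 hk (SimpleGraph.two_colorable_iff_forall_loop_even.1 hb v p)

end MixedGraph

open scoped Kronecker

/-! ### Characteristic polynomials of block matrices -/

section LinearAlgebra

theorem Matrix.charpoly_eq_of_mul_eq_mul {R n : Type*} [Field R] [Fintype n] [DecidableEq n]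
    (M N : Matrix n n R) (d : n → R) (hd : ∀ i, d i ≠ 0)
    (h : ∀ i j, M i j * d j = d i * N i j) : M.charpoly = N.charpoly := by
  let U : (Matrix n n R)ˣ :=
    ⟨Matrix.diagonal d, Matrix.diagonal fun i => (d i)⁻¹, by simp [hd], by simp [hd]⟩
  have hU : M * U.val = U.val * N := by
    ext i j
    simp [U, h]
  rw [← Matrix.charpoly_units_conj U N, ← hU, mul_assoc, ← Matrix.coe_units_inv,
    U.mul_inv, mul_one]

theorem Matrix.roots_charpoly_neg {R n : Type*} [CommRing R] [IsDomain R] [Fintype n]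
    [DecidableEq n] (M : Matrix n n R) :
    (-M).charpoly.roots = M.charpoly.roots.map fun μ => -μ := by
  have h : M.charpoly.comp (-Polynomial.X) = (-1) ^ Fintype.card n * (-M).charpoly := by
    rw [Matrix.charpoly, Matrix.charpoly, ← Matrix.det_neg, ← Polynomial.coe_compRingHom_apply,
      RingHom.map_det]
    congr 1
    ext i j : 2
    by_cases hij : i = j <;> simp [hij]
    ring
  rw [← Polynomial.roots_comp_neg_X, h]
  rcases neg_one_pow_eq_or (Polynomial R) (Fintype.card n) with h | h <;> simp [h]

variable {F ι κ : Type*} [Fintype ι] [DecidableEq ι] [Fintype κ] [DecidableEq κ]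

/-- The two vertices `0`, `1` are attached to the vertices `e 0`, `e 1` of every one of the copies,
indexed by `ι`, of a graph on `κ`, with the weights `β`: the block of the rows `0`, `1`. -/
def Matrix.attachRow [Zero F] (e : Fin 2 → κ) (β : ι → Fin 2 → F) : Matrix (Fin 2) (ι × κ) F :=
  Matrix.of fun a w => if w.2 = e a then β w.1 a else 0

theorem Matrix.attachRow_mul_mul_transpose [CommRing F] (e : Fin 2 → κ) (β γ : ι → Fin 2 → F)
    (Q : Matrix κ κ F) :
    Matrix.attachRow e β * ((1 : Matrix ι ι F) ⊗ₖ Q) * (Matrix.attachRow e γ).transpose =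
      Matrix.of fun a b => (∑ σ, β σ a * γ σ b) * Q (e a) (e b) := by
  ext a b
  simp only [Matrix.mul_apply, Matrix.attachRow, Matrix.of_apply, Matrix.kroneckerMap_apply,
    Matrix.one_apply, Matrix.transpose_apply, Fintype.sum_prod_type, ite_mul, mul_ite, zero_mul,
    mul_zero, one_mul, Finset.sum_ite_eq', Finset.mem_univ, if_true]
  simp [Finset.sum_mul, mul_right_comm]

/-- The determinant as a Schur complement of the copies of `D`: they only contribute the entries of
`D⁻¹` at the vertices of attachment. -/
theorem Matrix.det_attach [Field F] (A : Matrix (Fin 2) (Fin 2) F) (e : Fin 2 → κ)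
    (β γ : ι → Fin 2 → F) (D : Matrix κ κ F) (hdet : D.det ≠ 0) :
    (Matrix.fromBlocks A (Matrix.attachRow e β) (Matrix.attachRow e γ).transpose
        ((1 : Matrix ι ι F) ⊗ₖ D)).det =
      ((1 : Matrix ι ι F) ⊗ₖ D).det *
        (A - Matrix.of fun a b => (∑ σ, β σ a * γ σ b) * D⁻¹ (e a) (e b)).det := by
  have hu : IsUnit ((1 : Matrix ι ι F) ⊗ₖ D).det := by
    rw [Matrix.det_kronecker]
    simp [hdet]
  let := Matrix.invertibleOfIsUnitDet _ hu
  rw [Matrix.det_fromBlocks₂₂, Matrix.invOf_eq_nonsing_inv, Matrix.inv_kronecker, inv_one,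
    Matrix.attachRow_mul_mul_transpose]

open Polynomial in
/-- The sign of the edge between the two attached vertices does not affect the characteristic
polynomial if the cycles through this edge have total weight `0`: over the fraction field of `F[X]`
the Schur complement is a `2 × 2` matrix, and this total weight is the factor of the part of its
determinant that is linear in `a` and `b`. -/
theorem Matrix.charpoly_attach_neg [Field F] (a b : F) (e : Fin 2 → κ) (β γ : ι → Fin 2 → F)
    (P : Matrix κ κ F) (hP : P.IsSymm)
    (h : a * ∑ σ, β σ 1 * γ σ 0 + b * ∑ σ, β σ 0 * γ σ 1 = 0) :
    (Matrix.fromBlocks (-!![0, a; b, 0]) (Matrix.attachRow e β) (Matrix.attachRow e γ).transpose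
        ((1 : Matrix ι ι F) ⊗ₖ P)).charpoly =
      (Matrix.fromBlocks !![0, a; b, 0] (Matrix.attachRow e β) (Matrix.attachRow e γ).transpose
        ((1 : Matrix ι ι F) ⊗ₖ P)).charpoly := by
  let φ : F[X] →+* FractionRing F[X] := algebraMap _ _
  have hφ : Function.Injective φ := IsFractionRing.injective _ _
  apply hφ
  set D : Matrix κ κ (FractionRing F[X]) := P.charmatrix.map φ with hD
  have hdet : D.det ≠ 0 := by
    rw [hD, ← RingHom.mapMatrix_apply, ← RingHom.map_det]
    exact (map_ne_zero_iff φ hφ).2 (Matrix.charpoly_monic P).ne_zero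
  have hsymm : D⁻¹ (e 1) (e 0) = D⁻¹ (e 0) (e 1) := by
    have : D.IsSymm := by
      ext i j
      have hij := hP.apply i j
      by_cases h : i = j
      · simp [h]
      · simp [hD, h, Ne.symm h, hij]
    exact this.inv.apply _ _
  have key : ∀ A : Matrix (Fin 2) (Fin 2) F,
      φ (Matrix.fromBlocks A (Matrix.attachRow e β) (Matrix.attachRow e γ).transpose
        ((1 : Matrix ι ι F) ⊗ₖ P)).charpoly =
      ((1 : Matrix ι ι _) ⊗ₖ D).det *
        (A.charmatrix.map φ - Matrix.of fun a b =>
          (∑ σ, φ (C (β σ a)) * φ (C (γ σ b))) * D⁻¹ (e a) (e b)).det := by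
    intro A
    -- the off-diagonal blocks of the characteristic matrix are negated
    have := Matrix.det_attach (A.charmatrix.map φ) e (fun σ a => - φ (C (β σ a)))
      (fun σ a => - φ (C (γ σ a))) D hdet
    simp only [neg_mul_neg] at this
    rw [← this, Matrix.charpoly, RingHom.map_det, Matrix.charmatrix_fromBlocks]
    congr 1
    ext (i | ⟨σ, i⟩) (j | ⟨τ, j⟩)
    · simp
    · simp [Matrix.attachRow, apply_ite φ, apply_ite C]
      split_ifs <;> simp
    · simp [Matrix.attachRow, apply_ite φ, apply_ite C]
      split_ifs <;> simp
    · by_cases h1 : σ = τ <;> by_cases h2 : i = j <;> simp [hD, h1, h2]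
  rw [key, key]
  congr 1
  have h' := congrArg (fun p => φ (C p)) h
  simp only [map_add, map_mul, map_sum, map_zero] at h'
  simp only [Matrix.det_fin_two, Matrix.sub_apply, Matrix.map_apply, Matrix.charmatrix_apply,
    Matrix.of_apply, hsymm]
  simp
  linear_combination (-2 * D⁻¹ (e 0) (e 1)) * h'

end LinearAlgebra

/-! ### The gains of the sheets -/

namespace MixedGraph

/-- The product of the gains along the path from `x` to `y` through a sheet, closed by the gain `a`
of the edge between `y` and `x`. -/
theorem mul_prod_range_gain {R : Type*} [CommRing R] (a b : R) (hab : a * b = 1) {t j : ℕ}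
    (hj : j < t) :
    a * ∏ k ∈ Finset.range (2 * t - 2), (if TowardsX t j k then a else b) = a ^ (2 * j + 1) := by
  obtain ⟨c, rfl⟩ : ∃ c, t = c + j + 1 := ⟨t - 1 - j, by omega⟩
  have h : 2 * (c + j + 1) - 2 = (c + j) + c + j := by omega
  rw [h, Finset.prod_range_add, Finset.prod_range_add,
    Finset.prod_congr (g := fun _ => a) rfl (fun k hk => if_pos ?_),
    Finset.prod_congr (g := fun _ => b) rfl (fun k hk => if_neg ?_),
    Finset.prod_congr (g := fun _ => a) rfl (fun k hk => if_pos ?_)]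
  · simp only [Finset.prod_const, Finset.card_range]
    have hc : a ^ c * b ^ c = 1 := by rw [← mul_pow, hab, one_pow]
    linear_combination (a ^ (2 * j + 1)) * hc
  all_goals
    rw [Finset.mem_range] at hk
    unfold TowardsX
    omega

theorem sum_bookSheet {M : Type*} [AddCommMonoid M] {t : ℕ} (s : Fin t → ℕ) (f : ℕ → M) :
    ∑ σ : BookSheet s, f σ.1 = ∑ j, s j • f j := by
  rw [Fintype.sum_sigma]
  simp

theorem sum_bookSheet_twosOne {M : Type*} [AddCommMonoid M] (n : ℕ) (f : ℕ → M) :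
    ∑ σ : BookSheet (twosOne n), f σ.1 = ∑ j ∈ Finset.range n, 2 • f j + f n := by
  rw [sum_bookSheet, Fin.sum_univ_castSucc, Finset.sum_range]
  simp [twosOne]

/-- The sum telescopes after multiplication by `a - b`. -/
theorem sum_twosOne_pow_add_pow {K : Type*} [Field K] (n : ℕ) (a b : K) (hab : a * b = 1)
    (hne : a ≠ b) (hpow : a ^ (2 * n + 1) = b ^ (2 * n + 1)) :
    ∑ σ : BookSheet (twosOne n), (a ^ (2 * (σ.1 : ℕ) + 1) + b ^ (2 * (σ.1 : ℕ) + 1)) = 0 := by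
  rw [sum_bookSheet_twosOne n fun j => a ^ (2 * j + 1) + b ^ (2 * j + 1)]
  have htel : ∀ k, (a - b) * ∑ j ∈ Finset.range k, 2 • (a ^ (2 * j + 1) + b ^ (2 * j + 1)) =
      2 * (a ^ (2 * k) - b ^ (2 * k)) := by
    intro k
    induction k with
    | zero => simp
    | succ k ih =>
      rw [Finset.sum_range_succ, mul_add, ih, nsmul_eq_mul]
      push_cast
      linear_combination (2 * b ^ (2 * k) - 2 * a ^ (2 * k)) * hab
  apply (mul_eq_zero.1 _).resolve_left (sub_ne_zero.2 hne)
  rw [mul_add, htel]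
  linear_combination (2 * b ^ (2 * n) - 2 * a ^ (2 * n)) * hab + (a + b) * hpow

theorem exp_pow_eq_exp_neg_pow (l : ℤ) {m : ℕ} (hm : m ≠ 0) (θ : ℝ)
    (hθ : θ = (l : ℝ) / (m : ℝ) * Real.pi) :
    Complex.exp (Complex.I * θ) ^ m = Complex.exp (-(Complex.I * θ)) ^ m := by
  rw [← Complex.exp_nat_mul, ← Complex.exp_nat_mul, Complex.exp_eq_exp_iff_exists_int]
  refine ⟨l, ?_⟩
  have : (m : ℂ) ≠ 0 := by exact_mod_cast hm
  rw [hθ]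
  push_cast
  field_simp
  ring

theorem exp_ne_exp_neg (l : ℤ) {m : ℕ} (hm : 1 < m) (hlm : IsCoprime l (m : ℤ)) (θ : ℝ)
    (hθ : θ = (l : ℝ) / (m : ℝ) * Real.pi) :
    Complex.exp (Complex.I * θ) ≠ Complex.exp (-(Complex.I * θ)) := by
  rw [Ne, Complex.exp_eq_exp_iff_exists_int]
  rintro ⟨k, hk⟩
  have hm0 : (m : ℂ) ≠ 0 := by
    have : m ≠ 0 := by omega
    exact_mod_cast this
  have hpi : (Real.pi : ℂ) ≠ 0 := by exact_mod_cast Real.pi_ne_zero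
  have h : (l : ℂ) = k * m := by
    rw [hθ] at hk
    push_cast at hk
    field_simp at hk
    have h2 : (2 * Complex.I * Real.pi : ℂ) ≠ 0 := by simp [hpi]
    apply mul_left_cancel₀ h2
    linear_combination (Complex.I * Real.pi) * hk
  have h' : l = k * m := by exact_mod_cast h
  have hu := hlm.isUnit_of_dvd' (Dvd.intro_left k h'.symm) dvd_rfl
  rw [Int.isUnit_iff] at hu
  omega

end MixedGraph

/-! ### The spectrum of a book graph -/

namespace MixedGraph

/-- The gain of the edge between the positions `k` and `k + 1` of a sheet of class `j`, read in the
direction of `x`, if arcs have the gain `z` and reversed arcs the gain `w`. -/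
def gain (t j : ℕ) (z w : ℂ) (k : ℕ) : ℂ := if TowardsX t j k then z else w

theorem gain_mul_gain_swap (t j : ℕ) {z w : ℂ} (hzw : z * w = 1) (k : ℕ) :
    gain t j z w k * gain t j w z k = 1 := by
  unfold gain
  split_ifs
  · exact hzw
  · rw [mul_comm, hzw]

/-- The adjacency matrix of the path with the vertices `0, …, n - 1`. -/
def pathMatrix (n : ℕ) : Matrix (Fin n) (Fin n) ℂ :=
  Matrix.of fun i j => if (i : ℕ) = j + 1 ∨ (j : ℕ) = i + 1 then 1 else 0

theorem pathMatrix_isSymm (n : ℕ) : (pathMatrix n).IsSymm := by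
  ext i j
  simp [pathMatrix, or_comm]

variable {t : ℕ} (ht : 2 ≤ t) (s : Fin t → ℕ)

/-- The neighbours of `x` and of `y` inside a sheet. -/
def sheetEnd : Fin 2 → Fin (2 * t - 3) := ![⟨0, by omega⟩, ⟨2 * t - 4, by omega⟩]

/-- The gains of the edges from `x` and `y` into the sheet `σ` after switching: all other gains in
the sheet are trivial, and the edge at `y` carries the gain of the whole path from `y` to `x`. The
reverse gains are obtained by exchanging `z` and `w`. -/
def sheetWeight (z w : ℂ) (σ : BookSheet s) : Fin 2 → ℂ :=
  ![1, ∏ k ∈ Finset.range (2 * t - 2), gain t σ.1 z w k]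

/-- The switching function that trivializes the gains inside the sheets. The factor `ε` is `1` for
the matrix itself and `-1` for its negative, whose entries inside the sheets change their sign. -/
def switching (ε z w : ℂ) : BookVertex s → ℂ
  | Sum.inl _ => 1
  | Sum.inr (σ, i) => ε ^ ((i : ℕ) + 1) * ∏ k ∈ Finset.range (i + 1), gain t σ.1 z w k

include ht in
/-- Both `H_θ(G)` and `-H_θ(G)` are diagonally similar to a block matrix that does not depend on the
sign, except for the entries of the edge `{x, y}`. -/
theorem charpoly_smul_hermitianAdjMatrix (θ : ℝ) (z w : ℂ) (hz : z = Complex.exp (Complex.I * θ))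
    (hw : w = Complex.exp (-(Complex.I * θ))) (ε : ℂ) (hε : ε * ε = 1) :
    (ε • (bookGraph s).hermitianAdjMatrix θ).charpoly =
      (Matrix.fromBlocks (ε • !![0, z; w, 0]) (Matrix.attachRow (sheetEnd ht) (sheetWeight s z w))
        (Matrix.attachRow (sheetEnd ht) (sheetWeight s w z)).transpose
        ((1 : Matrix (BookSheet s) (BookSheet s) ℂ) ⊗ₖ pathMatrix (2 * t - 3))).charpoly := by
  classical
  have hzw : z * w = 1 := by rw [hz, hw, ← Complex.exp_add, add_neg_cancel, Complex.exp_zero]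
  have hg : ∀ j k, gain t j w z k * gain t j z w k = 1 := fun j k =>
    gain_mul_gain_swap t j (by rw [mul_comm, hzw]) k
  -- the entries of the matrix, using that there are no digons
  have hH : ∀ u v, (bookGraph s).hermitianAdjMatrix θ u v =
      if (bookGraph s).Arc u v then z else if (bookGraph s).Arc v u then w else 0 := by
    intro u v
    simp only [hermitianAdjMatrix, Matrix.of_apply, bookGraph_isOriented ht s u v, if_false, hz, hw]
  have hxr : ∀ τ j, (bookGraph s).hermitianAdjMatrix θ (Sum.inl 0) (Sum.inr (τ, j)) =
      if (j : ℕ) = 0 then w else 0 := fun τ j => by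
    simp [hH, not_bookGraph_arc_bookX_inr ht, bookGraph_arc_inr_bookX ht]
  have hrx : ∀ τ j, (bookGraph s).hermitianAdjMatrix θ (Sum.inr (τ, j)) (Sum.inl 0) =
      if (j : ℕ) = 0 then z else 0 := fun τ j => by
    simp [hH, not_bookGraph_arc_bookX_inr ht, bookGraph_arc_inr_bookX ht]
  have hyr : ∀ τ j, (bookGraph s).hermitianAdjMatrix θ (Sum.inl 1) (Sum.inr (τ, j)) =
      if (j : ℕ) = 2 * t - 4 then gain t τ.1 z w (2 * t - 3) else 0 := fun τ j => by
    rw [hH, bookGraph_arc_bookY_inr ht, bookGraph_arc_inr_bookY ht, gain]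
    split_ifs <;> tauto
  have hry : ∀ τ j, (bookGraph s).hermitianAdjMatrix θ (Sum.inr (τ, j)) (Sum.inl 1) =
      if (j : ℕ) = 2 * t - 4 then gain t τ.1 w z (2 * t - 3) else 0 := fun τ j => by
    rw [hH, bookGraph_arc_bookY_inr ht, bookGraph_arc_inr_bookY ht, gain]
    split_ifs <;> tauto
  have hrr : ∀ σ τ i j, (bookGraph s).hermitianAdjMatrix θ (Sum.inr (σ, i)) (Sum.inr (τ, j)) =
      if σ = τ then if (i : ℕ) = j + 1 then gain t σ.1 z w i
        else if (j : ℕ) = i + 1 then gain t σ.1 w z j else 0 else 0 := fun σ τ i j => by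
    rw [hH, bookGraph_arc_inr_inr ht, bookGraph_arc_inr_inr ht]
    by_cases hst : σ = τ
    · subst hst
      have : ¬ ((i : ℕ) = j + 1 ∧ (j : ℕ) = i + 1) := by omega
      simp only [true_and, if_true, gain]
      split_ifs <;> tauto
    · simp [hst, Ne.symm hst]
  -- the last edge of a sheet has the odd number `2 t - 3`, so `ε` drops out there
  have e1 : 2 * t - 2 = 2 * t - 4 + 1 + 1 := by omega
  have e2 : ε ^ (2 * t - 4 + 1) = ε := by
    rw [show 2 * t - 4 = 2 * (t - 2) by omega, pow_succ, pow_mul, sq, hε, one_pow, one_mul]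
  have e3 : 2 * t - 3 = 2 * t - 4 + 1 := by omega
  apply Matrix.charpoly_eq_of_mul_eq_mul _ _ (switching s ε z w)
  · rintro (a | ⟨σ, i⟩)
    · exact one_ne_zero
    · refine mul_ne_zero (pow_ne_zero _ (left_ne_zero_of_mul_eq_one hε))
        (Finset.prod_ne_zero_iff.2 fun k _ => right_ne_zero_of_mul_eq_one (hg _ k))
  · rintro (a | ⟨σ, i⟩) (b | ⟨τ, j⟩)
    · rw [Matrix.smul_apply, hH, bookGraph_arc_inl_inl ht, bookGraph_arc_inl_inl ht]
      fin_cases a <;> fin_cases b <;> simp [switching]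
    · obtain rfl | rfl : a = 0 ∨ a = 1 := by omega
      · rw [Matrix.smul_apply, hxr]
        by_cases hj : (j : ℕ) = 0
        · have hT : TowardsX t τ.1 0 := Or.inl (by omega)
          simp [hj, switching, Matrix.attachRow, sheetEnd, sheetWeight, Fin.ext_iff, gain, hT]
          linear_combination (w * z) * hε + hzw
        · simp [hj, switching, Matrix.attachRow, sheetEnd, Fin.ext_iff]
      · rw [Matrix.smul_apply, hyr]
        by_cases hj : (j : ℕ) = 2 * t - 4
        · simp only [hj, switching, Matrix.attachRow, sheetEnd, sheetWeight, Fin.ext_iff, e1, e2,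
            e3, Finset.prod_range_succ _ (2 * t - 4 + 1), Matrix.fromBlocks_apply₁₂, Matrix.of_apply,
            Matrix.cons_val_one, Matrix.cons_val_fin_one, if_true, smul_eq_mul]
          linear_combination (gain t τ.1 z w (2 * t - 4 + 1) *
            ∏ k ∈ Finset.range (2 * t - 4 + 1), gain t τ.1 z w k) * hε
        · simp [hj, switching, Matrix.attachRow, sheetEnd, Fin.ext_iff]
    · obtain rfl | rfl : b = 0 ∨ b = 1 := by omega
      · rw [Matrix.smul_apply, hrx]
        by_cases hi : (i : ℕ) = 0
        · have hT : TowardsX t σ.1 0 := Or.inl (by omega)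
          simp [hi, switching, Matrix.attachRow, sheetEnd, sheetWeight, Fin.ext_iff, gain, hT]
        · simp [hi, switching, Matrix.attachRow, sheetEnd, Fin.ext_iff]
      · rw [Matrix.smul_apply, hry]
        by_cases hi : (i : ℕ) = 2 * t - 4
        · have hprod : (∏ k ∈ Finset.range (2 * t - 4 + 1), gain t σ.1 z w k) *
              ∏ k ∈ Finset.range (2 * t - 4 + 1), gain t σ.1 w z k = 1 := by
            rw [← Finset.prod_mul_distrib]
            exact Finset.prod_eq_one fun k _ => by rw [mul_comm, hg]
          simp only [hi, switching, Matrix.attachRow, sheetEnd, sheetWeight, Fin.ext_iff, e1, e2,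
            e3, Finset.prod_range_succ _ (2 * t - 4 + 1), Matrix.fromBlocks_apply₂₁, Matrix.of_apply,
            Matrix.transpose_apply, Matrix.cons_val_one, Matrix.cons_val_fin_one, if_true,
            smul_eq_mul]
          linear_combination (-ε * gain t σ.1 w z (2 * t - 4 + 1)) * hprod
        · simp [hi, switching, Matrix.attachRow, sheetEnd, Fin.ext_iff]
    · rw [Matrix.smul_apply, hrr, Matrix.fromBlocks_apply₂₂, Matrix.kroneckerMap_apply,
        Matrix.one_apply, pathMatrix, Matrix.of_apply]
      by_cases hst : σ = τ
      · subst hst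
        simp only [if_true, switching, smul_eq_mul, one_mul]
        by_cases h1 : (i : ℕ) = j + 1
        · simp only [h1, true_or, if_true, Finset.prod_range_succ _ ((j : ℕ) + 1)]
          ring
        · by_cases h2 : (j : ℕ) = i + 1
          · rw [if_neg h1]
            simp only [h2, or_true, if_true, Finset.prod_range_succ _ ((i : ℕ) + 1)]
            linear_combination (ε ^ ((i : ℕ) + 1) *
              ∏ k ∈ Finset.range ((i : ℕ) + 1), gain t σ.1 z w k) *
              (gain t σ.1 w z (i + 1) * gain t σ.1 z w (i + 1) * hε + hg σ.1 (i + 1))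
          · simp [h1, h2]
      · simp [hst]

include ht in
/-- The summand is `2 cos ((2j - 1) θ)` for a sheet of class `j` counted from `1`, that is, twice
the real part of the gain of the cycle through this sheet. -/
theorem hasSymmetricSpectrum_of_sum_eq_zero (θ : ℝ)
    (h : ∑ σ : BookSheet s, (Complex.exp (Complex.I * θ) ^ (2 * (σ.1 : ℕ) + 1) +
      Complex.exp (-(Complex.I * θ)) ^ (2 * (σ.1 : ℕ) + 1)) = 0) :
    (bookGraph s).HasSymmetricSpectrum θ := by
  rw [HasSymmetricSpectrum, spec, ← Matrix.roots_charpoly_neg]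
  congr 1
  have h1 := charpoly_smul_hermitianAdjMatrix ht s θ _ _ rfl rfl 1 (by norm_num)
  have h2 := charpoly_smul_hermitianAdjMatrix ht s θ _ _ rfl rfl (-1) (by norm_num)
  rw [one_smul, one_smul] at h1
  rw [neg_one_smul, neg_one_smul] at h2
  rw [h1, h2]
  apply Matrix.charpoly_attach_neg _ _ _ _ _ _ (pathMatrix_isSymm _)
  have hzw : Complex.exp (Complex.I * θ) * Complex.exp (-(Complex.I * θ)) = 1 := by
    rw [← Complex.exp_add, add_neg_cancel, Complex.exp_zero]
  rw [Finset.mul_sum, Finset.mul_sum, ← Finset.sum_add_distrib, ← h]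
  refine Finset.sum_congr rfl fun σ _ => ?_
  rw [← mul_prod_range_gain _ _ hzw σ.1.isLt,
    ← mul_prod_range_gain _ _ ((mul_comm _ _).trans hzw) σ.1.isLt]
  simp [sheetWeight, gain]

end MixedGraph

theorem propositionm13 (l : ℤ) (m : ℕ) (hm : 1 < m) (hodd : Odd m)
    (hlm : IsCoprime l (m : ℤ)) (θ : ℝ) (hθ : θ = (l : ℝ) / (m : ℝ) * Real.pi) :
    (MixedGraph.bookGraph (MixedGraph.twosOne ((m - 1) / 2))).IsOriented ∧
    ¬ (MixedGraph.bookGraph (MixedGraph.twosOne ((m - 1) / 2))).IsBipartite ∧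
    (MixedGraph.bookGraph (MixedGraph.twosOne ((m - 1) / 2))).HasOddCircumference m ∧
    (MixedGraph.bookGraph (MixedGraph.twosOne ((m - 1) / 2))).HasSymmetricSpectrum θ := by
  obtain ⟨n, rfl⟩ := hodd
  have hn : (2 * n + 1 - 1) / 2 = n := by omega
  rw [hn]
  have ht : 2 ≤ n + 1 := by omega
  have hcirc : (MixedGraph.bookGraph (MixedGraph.twosOne n)).HasOddCircumference (2 * n + 1) :=
    MixedGraph.bookGraph_hasOddCircumference ht _
      ⟨Fin.last n, ⟨0, by simp [MixedGraph.twosOne]⟩⟩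
  refine ⟨MixedGraph.bookGraph_isOriented ht _,
    MixedGraph.not_isBipartite_of_hasOddCircumference hcirc, hcirc,
    MixedGraph.hasSymmetricSpectrum_of_sum_eq_zero ht _ θ ?_⟩
  apply MixedGraph.sum_twosOne_pow_add_pow
  · rw [← Complex.exp_add, add_neg_cancel, Complex.exp_zero]
  · exact MixedGraph.exp_ne_exp_neg l hm hlm θ hθ
  · exact MixedGraph.exp_pow_eq_exp_neg_pow l (by omega) θ hθ
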